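/- Let $K$ be a field and let $n>m\ge 2$ and $t\ge 1$ be integers. Let $S=K[x_1,\dots,x_n]$ and $S'=K[x_1,\dots,x_{n-1}]\subset S$. For $1\le m\le p$ let $I_{p,m}=(x_i x_{i+1}\cdots x_{i+m-1} : 1\le i\le p-m+1)$ be the $m$-path ideal of the path graph on $p$ vertices, an ideal of $K[x_1,\dots,x_p]$. Let $$J=J_{n,m}=I_{n,m}+(x_{n-m+2}\cdots x_nx_1,\ x_{n-m+3}\cdots x_nx_1x_2,\ \dots,\ x_nx_1\cdots x_{m-1})\subset S$$ be the $m$-path ideal of the cycle graph on $n$ vertices, and let $I=I_{n-1,m}\subset S'$ and $J'=(J:x_n)\cap S'$. Ideals of $S'$ are extended to $S$ where necessary. Then: 1. $(J^t,x_n^k)=(I^{t+1-k}J^{k-1},x_n^k)$ for all $1\le k\le t$. 2. $((J^t:x_n^{k-1}),x_n)=(I^{t+1-k}J'^{\,k-1},x_n)$ for all $1\le k\le t$. 3. $(J^t,x_n)=(I^t,x_n)$ and $(J^t:x_n^t)=J'^{\,t}S$. 4. $\operatorname{depth}(S/J^t)\le\operatorname{depth}(S'/J'^{\,t})+1$ and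 $\operatorname{sdepth}(S/J^t)\le\operatorname{sdepth}(S'/J'^{\,t})+1$. Here, over a polynomial ring $R$ over $K$ (with $R=S$ or $R=S'$), the depth of a module $M$ is the supremum of the lengths of the $M$-regular sequences in the ideal generated by the variables. For a monomial ideal $L\subsetneq R$, a Stanley decomposition of $R/L$ is a finite decomposition $R/L=\bigoplus_{i=1}^r u_iK[Z_i]$ into $K$-subspaces, where the $u_i$ are monomials, the $Z_i$ are sets of variables, $u_iK[Z_i]$ denotes the image of the map $K[Z_i]\to R/L$, $p\mapsto u_ip$, and these maps are injective; $\operatorname{sdepth}(R/L)$ is the maximum of $\min_i|Z_i|$ over all Stanley decompositions of $R/L$. -/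

import Mathlib

namespace CyclePath

open MvPolynomial

/-- The `m`-path ideal `I_{n,m} = (x₁⋯x_m, x₂⋯x_{m+1}, …, x_{n-m+1}⋯x_n)` of the path graph on
`n` vertices. The variables are indexed from `0`: the variable `x_i` is `X ⟨i - 1, _⟩`. -/
noncomputable def pathIdeal (K : Type*) [Field K] (n m : ℕ) : Ideal (MvPolynomial (Fin n) K) :=
  Ideal.span {f | ∃ i : ℕ, i + m ≤ n ∧
    f = ∏ l : Fin n with i ≤ l.val ∧ l.val < i + m, X l}

/-- The `m`-path ideal `J_{n,m}` of the cycle graph on `n` vertices: `I_{n,m}` together with the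
products of `m` cyclically consecutive variables that wrap around from `x_n` to `x_1`, that is
`x_{n-m+2}⋯x_n x_1, …, x_n x_1⋯x_{m-1}`. -/
noncomputable def cycleIdeal (K : Type*) [Field K] (n m : ℕ) : Ideal (MvPolynomial (Fin n) K) :=
  pathIdeal K n m ⊔ Ideal.span {f | ∃ i : ℕ, i < n ∧ n < i + m ∧
    f = ∏ l : Fin n with i ≤ l.val ∨ l.val + n < i + m, X l}

/-- The inclusion of `S' = K[x₁, …, x_{n-1}]` in `S = K[x₁, …, x_n]`. -/
noncomputable def incl (K : Type*) [Field K] (n : ℕ) :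
    MvPolynomial (Fin (n - 1)) K →+* MvPolynomial (Fin n) K :=
  (rename (Fin.castLE (Nat.sub_le n 1))).toRingHom

/-- The depth of a module `M` over `K[x_i : i ∈ σ]`: the supremum of the lengths of the
`M`-regular sequences in the ideal `(x_i : i ∈ σ)`. -/
noncomputable def depth (K : Type*) [Field K] (σ : Type*) (M : Type*) [AddCommGroup M]
    [Module (MvPolynomial σ K) M] : ℕ∞ :=
  ⨆ (rs : List (MvPolynomial σ K))
    (_ : (∀ r ∈ rs, r ∈ Ideal.span (Set.range (X : σ → MvPolynomial σ K))) ∧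
      RingTheory.Sequence.IsRegular M rs), (rs.length : ℕ∞)

/-- The `K`-linear map `K[Z] → S/I`, `p ↦ x^a p`. Its range is the subspace `x^a K[Z]` of `S/I`. -/
noncomputable def stanleyMap {K : Type*} [Field K] {σ : Type*} (I : Ideal (MvPolynomial σ K))
    (a : σ →₀ ℕ) (Z : Finset σ) :
    supported K (Z : Set σ) →ₗ[K] MvPolynomial σ K ⧸ I :=
  (Ideal.Quotient.mkₐ K I).toLinearMap ∘ₗ LinearMap.mulLeft K (monomial a (1 : K)) ∘ₗ
    (supported K (Z : Set σ)).val.toLinearMap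

/-- A Stanley decomposition `S/I = ⨁ x^{a_i} K[Z_i]` (a finite direct sum of `K`-subspaces) of the
quotient of a polynomial ring `S` by a monomial ideal `I`. As usual, each `x^{a_i} K[Z_i]` has to
be a Stanley space, i.e. free over `K[Z_i]`: multiplication `K[Z_i] → S/I` by `x^{a_i}` is
injective. All the summands are spanned by residue classes of monomials, hence are graded by the
exponent vectors. -/
structure StanleyDecomposition {K : Type*} [Field K] {σ : Type*}
    (I : Ideal (MvPolynomial σ K)) where
  r : ℕ
  a : Fin r → σ →₀ ℕ
  Z : Fin r → Finset σ
  free : ∀ i, Function.Injective (stanleyMap I (a i) (Z i))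
  isInternal : DirectSum.IsInternal fun i => LinearMap.range (stanleyMap I (a i) (Z i))

/-- The Stanley depth of a Stanley decomposition: the least number of variables `|Z_i|`. -/
noncomputable def StanleyDecomposition.sdepth {K : Type*} [Field K] {σ : Type*}
    {I : Ideal (MvPolynomial σ K)} (D : StanleyDecomposition I) : ℕ∞ :=
  ⨅ i, ((D.Z i).card : ℕ∞)

/-- The Stanley depth of `S/I`, for a monomial ideal `I` of a polynomial ring `S`. -/
noncomputable def sdepth {K : Type*} [Field K] {σ : Type*} (I : Ideal (MvPolynomial σ K)) : ℕ∞ :=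
  ⨆ D : StanleyDecomposition I, D.sdepth

end CyclePath

/-! View $S$ as $R[X]$ with $R=S'$ and $X=x_n$. Sorting the cyclic windows by whether they contain
$x_n$ gives $J=I+XJ'$ with $I\subseteq J'$ (`map_cycleIdeal_succ`). Hence $J^t$ is graded in $X$:
its component in degree $j$ is $I^{t-j}J'^{\min(j,t)}$ (`mem_gradedIdeal_pow_iff`), and this
increases with $j$ until it becomes constantly $J'^t$ for $j\ge t$. The ideal identities are then
comparisons of components.

For depth, let $L\subseteq R[X]$ be any ideal graded in $X$ whose components $L_j$ stabilise at
$L_T$; then $\operatorname{depth} R[X]/L\le\operatorname{depth} R/L_T+1$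
(`XHomogeneous.depthGE_coeffIdeal`). Once the left side is at least 2, no $R/L_j$ has a socle, so
prime avoidance gives one $f\in\mathfrak m\subset R$ regular modulo each of the finitely many
distinct $L_j$. Such an $f$ is regular modulo $L$; dividing by it lowers the depth by at most one
and keeps the shape of $L$, so induction applies.

For Stanley depth, a decomposition is a partition of the monomials outside the ideal. Its slice at a
large fixed exponent of $x_n$ is such a partition for $J'^t$, and each surviving piece loses only
the variable $x_n$ (`sdepth_le_sdepth_add_one`). -/

namespace CyclePath

/-! ### Depth of cyclic modules: socles, exchange and prime avoidance. -/

section Regular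

open scoped Pointwise

variable {A : Type*} [CommRing A]

/-- `c` is a nonzerodivisor on `A ⧸ Q`. -/
def RegularMod (Q : Ideal A) (c : A) : Prop := ∀ a, c * a ∈ Q → a ∈ Q

/-- `A ⧸ Q` has no nonzero element annihilated by `m`. -/
def SocleFree (m Q : Ideal A) : Prop := ∀ a, (∀ y ∈ m, y * a ∈ Q) → a ∈ Q

/-- There is a weakly `A ⧸ Q`-regular sequence of length `d` in `m`. -/
def DepthGE (m : Ideal A) : ℕ → Ideal A → Prop
  | 0, _ => True
  | d + 1, Q => ∃ f ∈ m, RegularMod Q f ∧ DepthGE m d (Q ⊔ Ideal.span {f})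

lemma mem_sup_span_singleton_iff {Q : Ideal A} {f a : A} :
    a ∈ Q ⊔ Ideal.span {f} ↔ ∃ b, a - f * b ∈ Q := by
  constructor
  · intro h
    obtain ⟨q, hq, z, hz, rfl⟩ := Submodule.mem_sup.mp h
    obtain ⟨b, rfl⟩ := Ideal.mem_span_singleton'.mp hz
    exact ⟨b, by convert hq using 1; ring⟩
  · rintro ⟨b, hb⟩
    have h := Ideal.add_mem _ (Ideal.mem_sup_left (T := Ideal.span {f}) hb)
      (Ideal.mem_sup_right (S := Q) (Ideal.mem_span_singleton'.mpr ⟨b, rfl⟩))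
    convert h using 1; ring

lemma RegularMod.socleFree {m Q : Ideal A} {f : A} (hf : f ∈ m) (h : RegularMod Q f) :
    SocleFree m Q := fun a ha => h a (ha f hf)

lemma DepthGE.socleFree {m Q : Ideal A} {d : ℕ} (h : DepthGE m (d + 1) Q) : SocleFree m Q := by
  obtain ⟨f, hf, hr, -⟩ := h
  exact hr.socleFree hf

/-- The vanishing of the socle of `A ⧸ (Q, f)` does not depend on the regular element `f`. -/
lemma SocleFree.exchange {m Q : Ideal A} {f g : A} (hfm : f ∈ m) (hf : RegularMod Q f)
    (hg : RegularMod Q g) (h : SocleFree m (Q ⊔ Ideal.span {f})) :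
    SocleFree m (Q ⊔ Ideal.span {g}) := by
  intro a ha
  obtain ⟨b, hb⟩ := mem_sup_span_singleton_iff.mp (ha f hfm)
  have hbm : b ∈ Q ⊔ Ideal.span {f} := by
    refine h b fun y hy => ?_
    obtain ⟨z, hz⟩ := mem_sup_span_singleton_iff.mp (ha y hy)
    refine mem_sup_span_singleton_iff.mpr ⟨z, hg _ ?_⟩
    convert Q.sub_mem (Q.mul_mem_left f hz) (Q.mul_mem_left y hb) using 1
    ring
  obtain ⟨c, hc⟩ := mem_sup_span_singleton_iff.mp hbm
  refine mem_sup_span_singleton_iff.mpr ⟨c, hf _ ?_⟩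
  convert Q.add_mem hb (Q.mul_mem_left g hc) using 1
  ring

/-- If `f, c` is regular and `c` is regular, then `f` is regular modulo `c`. -/
lemma RegularMod.swap {Q : Ideal A} {f c : A} (hf : RegularMod Q f)
    (hc : RegularMod (Q ⊔ Ideal.span {f}) c) : RegularMod (Q ⊔ Ideal.span {c}) f := by
  intro a ha
  obtain ⟨b, hb⟩ := mem_sup_span_singleton_iff.mp ha
  have hbm : c * b ∈ Q ⊔ Ideal.span {f} := by
    refine mem_sup_span_singleton_iff.mpr ⟨a, ?_⟩
    convert Q.neg_mem hb using 1
    ring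
  obtain ⟨z, hz⟩ := mem_sup_span_singleton_iff.mp (hc _ hbm)
  refine mem_sup_span_singleton_iff.mpr ⟨z, hf _ ?_⟩
  convert Q.add_mem hb (Q.mul_mem_left c hz) using 1
  ring

/-- Otherwise `m` is covered by the finitely many associated primes of the quotients, hence lies in
one of them. That prime is the annihilator of a nonzero class, which is then a socle element. -/
lemma exists_regularMod [IsNoetherianRing A] {m : Ideal A} {F : Set (Ideal A)} (hF : F.Finite)
    (h : ∀ Q ∈ F, SocleFree m Q) : ∃ c ∈ m, ∀ Q ∈ F, RegularMod Q c := by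
  by_contra! hcon
  have hfin : (⋃ Q ∈ F, associatedPrimes A (A ⧸ Q)).Finite :=
    hF.biUnion fun Q _ => associatedPrimes.finite A (A ⧸ Q)
  have hsub : (m : Set A) ⊆
      ⋃ p ∈ ⋃ Q ∈ F, associatedPrimes A (A ⧸ Q), ((id p : Ideal A) : Set A) := by
    intro c hc
    obtain ⟨Q, hQ, hr⟩ := hcon c hc
    simp only [RegularMod, not_forall] at hr
    obtain ⟨a, ha, haQ⟩ := hr
    have hz : c ∈ ⋃ p ∈ associatedPrimes A (A ⧸ Q), (p : Set A) := by
      rw [biUnion_associatedPrimes_eq_zero_divisors]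
      refine ⟨Ideal.Quotient.mk Q a, by rwa [Ne, Ideal.Quotient.eq_zero_iff_mem], ?_⟩
      rw [Algebra.smul_def, Ideal.Quotient.algebraMap_eq, ← map_mul]
      exact Ideal.Quotient.eq_zero_iff_mem.mpr ha
    simp only [Set.mem_iUnion] at hz ⊢
    obtain ⟨p, hp, hcp⟩ := hz
    exact ⟨p, ⟨Q, hQ, hp⟩, hcp⟩
  have hprime : ∀ p ∈ ⋃ Q ∈ F, associatedPrimes A (A ⧸ Q), p ≠ (⊥ : Ideal A) → p ≠ (⊥ : Ideal A) →
      (id p : Ideal A).IsPrime := by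
    intro p hp _ _
    simp only [Set.mem_iUnion] at hp
    obtain ⟨Q, _, hp⟩ := hp
    exact IsAssociatedPrime.isPrime hp
  -- Prime avoidance tolerates two non-prime ideals; here all are prime, so `⊥ ⊥` are placeholders.
  obtain ⟨p, hp, hmp⟩ := (Ideal.subset_union_prime_finite hfin ⊥ ⊥ hprime).mp hsub
  simp only [Set.mem_iUnion] at hp
  obtain ⟨Q, hQ, hp⟩ := hp
  obtain ⟨hpp, x, hx⟩ := isAssociatedPrime_iff.mp hp
  obtain ⟨a, rfl⟩ := Ideal.Quotient.mk_surjective x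
  have haQ : a ∈ Q := by
    refine h Q hQ a fun y hy => ?_
    have hy' : y ∈ p := hmp hy
    rw [hx, Submodule.mem_colon_singleton, Algebra.smul_def, Ideal.Quotient.algebraMap_eq,
      ← map_mul] at hy'
    exact Ideal.Quotient.eq_zero_iff_mem.mp hy'
  refine hpp.ne_top (Ideal.eq_top_iff_one _ |>.mpr ?_)
  rw [hx, Submodule.mem_colon_singleton, one_smul]
  exact Ideal.Quotient.eq_zero_iff_mem.mpr haQ

/-- For a regular sequence $g_1,\dots,g_{d+1}$ modulo $Q$, take for `F` the ideals
$Q+(g_1,\dots,g_i)$ with $1\le i\le d$; each is socle-free because $g_{i+1}$ is regular modulo it.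
If `c` is regular modulo all of them, repeated swapping moves it to the front, and $g_1,\dots,g_d$
remains regular modulo $Q+(c)$. -/
lemma DepthGE.exists_finite_forall_sup {m : Ideal A} {d : ℕ} : ∀ {Q : Ideal A},
    DepthGE m (d + 1) Q → ∃ F : Set (Ideal A), F.Finite ∧ (∀ P ∈ F, SocleFree m P) ∧
      ∀ c ∈ m, (∀ P ∈ F, RegularMod P c) → DepthGE m d (Q ⊔ Ideal.span {c}) := by
  induction d with
  | zero => exact fun _ => ⟨∅, Set.finite_empty, by simp, fun _ _ _ => trivial⟩
  | succ d ih =>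
    rintro Q ⟨g, hgm, hg, h⟩
    obtain ⟨F, hF, hFs, hFd⟩ := ih h
    refine ⟨insert (Q ⊔ Ideal.span {g}) F, hF.insert _, ?_, fun c hcm hc => ?_⟩
    · rintro P (rfl | hP)
      · exact h.socleFree
      · exact hFs P hP
    · refine ⟨g, hgm, hg.swap (hc _ (Set.mem_insert _ _)), ?_⟩
      rw [sup_right_comm]
      exact hFd c hcm fun P hP => hc P (Set.mem_insert_of_mem _ hP)

/-- Dividing by one regular element lowers the depth by at most one. -/
lemma DepthGE.sup_span_singleton [IsNoetherianRing A] {m : Ideal A} {d : ℕ} :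
    ∀ {Q : Ideal A} {f : A}, DepthGE m (d + 1) Q → f ∈ m → RegularMod Q f →
      DepthGE m d (Q ⊔ Ideal.span {f}) := by
  induction d with
  | zero => exact fun _ _ _ => trivial
  | succ d ih =>
    intro Q f hQ hfm hf
    have hsf : SocleFree m (Q ⊔ Ideal.span {f}) := by
      obtain ⟨g, hgm, hg, h⟩ := hQ
      exact h.socleFree.exchange hgm hg hf
    obtain ⟨F, hF, hFs, hFd⟩ := hQ.exists_finite_forall_sup
    -- One `c` serves both sides: it continues `f` to a regular sequence, and it can replace the
    -- last term of the given one. Induction then applies to `f` modulo $Q+(c)$.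
    obtain ⟨c, hcm, hc⟩ := exists_regularMod (hF.insert (Q ⊔ Ideal.span {f})) (m := m) (by
      rintro P (rfl | hP)
      · exact hsf
      · exact hFs P hP)
    have hcf := hc _ (Set.mem_insert _ _)
    refine ⟨c, hcm, hcf, ?_⟩
    rw [sup_right_comm]
    exact ih (hFd c hcm fun P hP => hc P (Set.mem_insert_of_mem _ hP)) hfm (hf.swap hcf)

lemma DepthGE.map {B : Type*} [CommRing B] (e : A ≃+* B) {m : Ideal A} {d : ℕ} : ∀ {Q : Ideal A},
    DepthGE m d Q → DepthGE (m.map e) d (Q.map e) := by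
  induction d with
  | zero => exact fun _ => trivial
  | succ d ih =>
    rintro Q ⟨f, hfm, hf, h⟩
    refine ⟨e f, Ideal.mem_map_of_mem e hfm, fun b hb => ?_, ?_⟩
    · obtain ⟨a, rfl⟩ := e.surjective b
      rw [← map_mul, Ideal.mem_map_of_equiv] at hb
      obtain ⟨q, hq, hqe⟩ := hb
      rw [e.injective hqe] at hq
      exact Ideal.mem_map_of_mem e (hf a hq)
    · have := ih h
      rwa [Ideal.map_sup, Ideal.map_span, Set.image_singleton] at this

/-- The surjection `π` keeps the induction inside one class of modules: `QuotSMulTop f M` is again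
cyclic, but is not literally a quotient of `A` by an ideal. -/
lemma depthGE_iff_exists_isWeaklyRegular {m : Ideal A} (d : ℕ) :
    ∀ (M : Type _) [AddCommGroup M] [Module A M] (π : A →ₗ[A] M), Function.Surjective π →
      (DepthGE m d (LinearMap.ker π) ↔ ∃ rs : List A, rs.length = d ∧ (∀ r ∈ rs, r ∈ m) ∧
        RingTheory.Sequence.IsWeaklyRegular M rs) := by
  induction d with
  | zero =>
    intro M _ _ π _
    exact iff_of_true trivial ⟨[], rfl, by simp, .nil A M⟩
  | succ d ih =>
    intro M _ _ π hπ
    have hreg : ∀ f, RegularMod (LinearMap.ker π) f ↔ IsSMulRegular M f := by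
      intro f
      rw [isSMulRegular_iff_right_eq_zero_of_smul, hπ.forall]
      simp only [RegularMod, LinearMap.mem_ker, ← map_smul, smul_eq_mul]
    have hker : ∀ f, LinearMap.ker ((Submodule.mkQ (f • (⊤ : Submodule A M))) ∘ₗ π) =
        LinearMap.ker π ⊔ Ideal.span {f} := by
      intro f
      ext a
      rw [mem_sup_span_singleton_iff, LinearMap.mem_ker, LinearMap.comp_apply,
        Submodule.mkQ_apply, Submodule.Quotient.mk_eq_zero, Submodule.mem_smul_pointwise_iff_exists]
      simp only [Submodule.mem_top, true_and, hπ.exists, LinearMap.mem_ker, map_sub, sub_eq_zero,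
        ← map_smul, smul_eq_mul, eq_comm (a := π a)]
    have key : ∀ f, DepthGE m d (LinearMap.ker π ⊔ Ideal.span {f}) ↔
        ∃ rs : List A, rs.length = d ∧ (∀ r ∈ rs, r ∈ m) ∧
          RingTheory.Sequence.IsWeaklyRegular (QuotSMulTop f M) rs := by
      intro f
      rw [← hker]
      exact ih _ _ ((Submodule.mkQ_surjective _).comp hπ)
    constructor
    · rintro ⟨f, hfm, hf, h⟩
      obtain ⟨rs, hl, hm, hrs⟩ := (key f).mp h
      exact ⟨f :: rs, by simp [hl], by simpa [hfm] using hm, .cons ((hreg f).mp hf) hrs⟩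
    · rintro ⟨rs, hl, hm, hrs⟩
      obtain ⟨f, rs, rfl⟩ := List.exists_cons_of_length_eq_add_one hl
      rw [RingTheory.Sequence.isWeaklyRegular_cons_iff] at hrs
      exact ⟨f, hm f (by simp), (hreg f).mpr hrs.1, (key f).mpr
        ⟨rs, by simpa using hl, fun r hr => hm r (by simp [hr]), hrs.2⟩⟩

end Regular

/-! ### Depth of quotients of $R[X]$ by ideals graded in $X$. -/

section Homogeneous

open Polynomial

variable {R : Type*} [CommRing R]

/-- `L` is homogeneous with respect to the degree in `X`. -/
def XHomogeneous (L : Ideal R[X]) : Prop := ∀ p ∈ L, ∀ j, C (p.coeff j) * X ^ j ∈ L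

/-- The ideal of the coefficients `r` with `r X ^ j ∈ L`. -/
noncomputable def coeffIdeal (L : Ideal R[X]) (j : ℕ) : Ideal R := (L.colon {X ^ j}).comap C

lemma mem_coeffIdeal {L : Ideal R[X]} {j : ℕ} {r : R} :
    r ∈ coeffIdeal L j ↔ C r * X ^ j ∈ L := by
  rw [coeffIdeal, Ideal.mem_comap, Submodule.mem_colon_singleton, smul_eq_mul]

lemma coeffIdeal_mono (L : Ideal R[X]) : Monotone (coeffIdeal L) := by
  refine monotone_nat_of_le_succ fun j r hr => ?_
  rw [mem_coeffIdeal] at hr ⊢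
  rw [pow_succ, ← mul_assoc]
  exact L.mul_mem_right _ hr

lemma XHomogeneous.mem_iff {L : Ideal R[X]} (hL : XHomogeneous L) {p : R[X]} :
    p ∈ L ↔ ∀ j, p.coeff j ∈ coeffIdeal L j := by
  refine ⟨fun h j => mem_coeffIdeal.mpr (hL p h j), fun h => ?_⟩
  rw [p.as_sum_range_C_mul_X_pow]
  exact L.sum_mem fun j _ => mem_coeffIdeal.mp (h j)

lemma coeffIdeal_sup_span_C {L : Ideal R[X]} (hL : XHomogeneous L) (f : R) (j : ℕ) :
    coeffIdeal (L ⊔ Ideal.span {C f}) j = coeffIdeal L j ⊔ Ideal.span {f} := by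
  ext r
  rw [mem_coeffIdeal, mem_sup_span_singleton_iff, mem_sup_span_singleton_iff]
  constructor
  · rintro ⟨b, hb⟩
    refine ⟨b.coeff j, ?_⟩
    have := hL.mem_iff.mp hb j
    simpa using this
  · rintro ⟨b, hb⟩
    refine ⟨C b * X ^ j, ?_⟩
    rw [mem_coeffIdeal] at hb
    convert hb using 1
    simp only [map_sub, map_mul]; ring

lemma XHomogeneous.sup_span_C {L : Ideal R[X]} (hL : XHomogeneous L) (f : R) :
    XHomogeneous (L ⊔ Ideal.span {C f}) := by
  intro p hp j
  rw [← mem_coeffIdeal, coeffIdeal_sup_span_C hL, mem_sup_span_singleton_iff]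
  obtain ⟨b, hb⟩ := mem_sup_span_singleton_iff.mp hp
  exact ⟨b.coeff j, by simpa using hL.mem_iff.mp hb j⟩

lemma XHomogeneous.regularMod_C {L : Ideal R[X]} (hL : XHomogeneous L) {f : R}
    (hf : ∀ j, RegularMod (coeffIdeal L j) f) : RegularMod L (C f) := by
  intro p hp
  rw [hL.mem_iff] at hp ⊢
  exact fun j => hf j _ (by simpa using hp j)

lemma mul_mem_of_mem_map_C {L : Ideal R[X]} {m : Ideal R} {l a : R[X]} (hl : l ∈ m.map C)
    (ha : ∀ y ∈ m, C y * a ∈ L) : l * a ∈ L := by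
  have : m.map C ≤ L.colon {a} := by
    rw [Ideal.map_le_iff_le_comap]
    intro y hy
    rw [Ideal.mem_comap, Submodule.mem_colon_singleton]
    exact ha y hy
  exact Submodule.mem_colon_singleton.mp (this hl)

/-- On elements killed by `m`, the regular element $f\in\mathfrak mR[X]+(X)$ acts as $X\psi$ for
some $\psi$. Depth 2 is used to show that a socle element $v$ in degree $j$ satisfies $vX^j\equiv
Xa$ modulo $L$ with $\mathfrak m a\subseteq L$. So $v$ comes from a socle element in degree $j-1$,
and one descends to degree 0. -/
lemma XHomogeneous.socleFree_coeffIdeal {L : Ideal R[X]} (hL : XHomogeneous L) {m : Ideal R}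
    (h : DepthGE (m.map C ⊔ Ideal.span {X}) 2 L) (j : ℕ) : SocleFree m (coeffIdeal L j) := by
  obtain ⟨f, hfm, hf, hd⟩ := h
  obtain ⟨ψ, hl⟩ := mem_sup_span_singleton_iff.mp hfm
  have hsf := hd.socleFree
  induction j using Nat.strong_induction_on with
  | _ j ih =>
  intro v hv
  have hv' : ∀ y ∈ m, C y * (C v * X ^ j) ∈ L := by
    intro y hy
    rw [← mul_assoc, ← C_mul]
    exact mem_coeffIdeal.mp (hv y hy)
  -- It lies in the socle modulo $L+(f)$: `m` kills it, and multiplying it by $X$ amounts to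
  -- multiplying $vX^j$ by $f$.
  have hw : ψ * (C v * X ^ j) ∈ L ⊔ Ideal.span {f} := by
    refine hsf _ fun y hy => ?_
    obtain ⟨q, hq⟩ := mem_sup_span_singleton_iff.mp hy
    refine mem_sup_span_singleton_iff.mpr ⟨q * (C v * X ^ j), ?_⟩
    convert L.sub_mem (L.mul_mem_left ψ (mul_mem_of_mem_map_C hq hv'))
      (L.mul_mem_left q (mul_mem_of_mem_map_C hl hv')) using 1
    ring
  obtain ⟨a, ha⟩ := mem_sup_span_singleton_iff.mp hw
  have ham : ∀ y ∈ m, C y * a ∈ L := by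
    intro y hy
    refine hf _ ?_
    convert L.sub_mem (L.mul_mem_left ψ (hv' y hy)) (L.mul_mem_left (C y) ha) using 1
    ring
  -- Both terms are killed by `m`, so $f$ times the difference is $X(\psi vX^j-X\psi a)\equiv X(\psi
  -- vX^j-fa)\equiv 0$; cancel $f$.
  have hb : C v * X ^ j - X * a ∈ L := by
    have hbm : ∀ y ∈ m, C y * (C v * X ^ j - X * a) ∈ L := by
      intro y hy
      convert L.sub_mem (hv' y hy) (L.mul_mem_left X (ham y hy)) using 1
      ring
    refine hf _ ?_
    convert L.add_mem (mul_mem_of_mem_map_C hl hbm)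
      (L.mul_mem_left X (L.add_mem ha (mul_mem_of_mem_map_C hl ham))) using 1
    ring
  have hbj := hL.mem_iff.mp hb j
  cases j with
  | zero => simpa using hbj
  | succ j =>
    have haj : a.coeff j ∈ coeffIdeal L j := by
      refine ih j (Nat.lt_succ_self j) _ fun y hy => ?_
      simpa using hL.mem_iff.mp (ham y hy) j
    have hs := Ideal.add_mem _ hbj (coeffIdeal_mono L (Nat.le_succ j) haj)
    simpa [coeff_X_mul] using hs

lemma XHomogeneous.depthGE_coeffIdeal [IsNoetherianRing R] {m : Ideal R} {d T : ℕ} :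
    ∀ {L : Ideal R[X]}, XHomogeneous L → (∀ j ≥ T, coeffIdeal L j = coeffIdeal L T) →
      DepthGE (m.map C ⊔ Ideal.span {X}) (d + 1) L → DepthGE m d (coeffIdeal L T) := by
  induction d with
  | zero => exact fun _ _ _ => trivial
  | succ d ih =>
    intro L hL hT h
    have hsf : ∀ j, SocleFree m (coeffIdeal L j) := by
      refine hL.socleFree_coeffIdeal ?_
      obtain ⟨f, hf, hr, g, hg, hr', -⟩ := h
      exact ⟨f, hf, hr, g, hg, hr', trivial⟩
    -- By stabilisation the components of degree at most `T` are all of them, so prime avoidance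
    -- meets only finitely many ideals.
    obtain ⟨f, hfm, hf⟩ := exists_regularMod (m := m)
      ((Finset.range (T + 1)).finite_toSet.image (coeffIdeal L)) (by
        rintro _ ⟨j, -, rfl⟩
        exact hsf j)
    have hfj : ∀ j, RegularMod (coeffIdeal L j) f := by
      intro j
      rcases le_total j T with hj | hj
      · exact hf _ ⟨j, by simpa [Nat.lt_succ_iff] using hj, rfl⟩
      · rw [hT j hj]
        exact hf _ ⟨T, by simp, rfl⟩
    have hd := h.sup_span_singleton (Ideal.mem_sup_left (Ideal.mem_map_of_mem C hfm))
      (hL.regularMod_C hfj)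
    refine ⟨f, hfm, hfj T, ?_⟩
    rw [← coeffIdeal_sup_span_C hL]
    refine ih (hL.sup_span_C f) (fun j hj => ?_) hd
    rw [coeffIdeal_sup_span_C hL, coeffIdeal_sup_span_C hL, hT j hj]

end Homogeneous

/-! ### Components of the powers of $I+XJ'$. -/

section Powers

open Polynomial

variable {R : Type*} [CommRing R]

/-- The ideal of the polynomials with constant coefficient in `I` and all others in `J'`. -/
noncomputable def gradedIdeal (I J' : Ideal R) : Ideal R[X] :=
  I.map C ⊔ Ideal.span {X} * J'.map C

/-- Surplus factors from `I` may be counted as factors from `J'`, and surplus factors from `J'`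
dropped. -/
lemma pow_mul_pow_le {I J' : Ideal R} (h : I ≤ J') {a b c d : ℕ} (hca : c ≤ a)
    (hcd : c + d ≤ a + b) : I ^ a * J' ^ b ≤ I ^ c * J' ^ d := by
  obtain ⟨k, rfl⟩ := Nat.exists_eq_add_of_le hca
  rw [pow_add, mul_assoc]
  refine Ideal.mul_mono_right ?_
  calc I ^ k * J' ^ b ≤ J' ^ k * J' ^ b := Ideal.mul_mono_left (Ideal.pow_right_mono h k)
    _ = J' ^ (k + b) := (pow_add _ _ _).symm
    _ ≤ J' ^ d := Ideal.pow_le_pow_right (by omega)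

lemma coeff_mem_of_mem_gradedIdeal {I J' : Ideal R} (h : I ≤ J') {p : R[X]}
    (hp : p ∈ gradedIdeal I J') : p.coeff 0 ∈ I ∧ ∀ j, p.coeff j ∈ J' := by
  obtain ⟨q, hq, z, hz, rfl⟩ := Submodule.mem_sup.mp hp
  obtain ⟨w, hw, rfl⟩ := Ideal.mem_span_singleton_mul.mp hz
  rw [Ideal.mem_map_C_iff] at hq hw
  refine ⟨by simpa using hq 0, fun j => ?_⟩
  cases j with
  | zero => simpa using h (hq 0)
  | succ j => simpa [coeff_X_mul] using J'.add_mem (h (hq _)) (hw j)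

lemma C_mul_X_pow_mem_gradedIdeal_pow {I J' : Ideal R} {t j : ℕ} {r : R}
    (hr : r ∈ I ^ (t - j) * J' ^ min j t) : C r * X ^ j ∈ gradedIdeal I J' ^ t := by
  have hle : (I ^ (t - j) * J' ^ min j t).map C * Ideal.span {X} ^ j ≤ gradedIdeal I J' ^ t := by
    calc (I ^ (t - j) * J' ^ min j t).map C * Ideal.span {X} ^ j
        ≤ (I ^ (t - j) * J' ^ min j t).map C * Ideal.span {X} ^ min j t :=
          Ideal.mul_mono_right (Ideal.pow_le_pow_right (min_le_left _ _))
      _ = I.map C ^ (t - j) * (Ideal.span {X} * J'.map C) ^ min j t := by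
          rw [Ideal.map_mul, Ideal.map_pow, Ideal.map_pow]; ring
      _ ≤ gradedIdeal I J' ^ (t - j) * gradedIdeal I J' ^ min j t :=
          Ideal.mul_mono (Ideal.pow_right_mono le_sup_left _) (Ideal.pow_right_mono le_sup_right _)
      _ = gradedIdeal I J' ^ t := by rw [← pow_add]; congr 1; omega
  exact hle (Ideal.mul_mem_mul (Ideal.mem_map_of_mem C hr)
    (Ideal.pow_mem_pow (Ideal.mem_span_singleton_self X) j))

/-- In a product of $t$ factors, a term of degree $j$ takes positive degree from at most $j$ of
them; the other factors, at least $t-j$, contribute constant coefficients from `I`. -/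
lemma mem_gradedIdeal_pow_iff {I J' : Ideal R} (h : I ≤ J') {t : ℕ} {p : R[X]} :
    p ∈ gradedIdeal I J' ^ t ↔ ∀ j, p.coeff j ∈ I ^ (t - j) * J' ^ min j t := by
  constructor
  · intro hp
    induction t generalizing p with
    | zero => intro j; simp [Ideal.one_eq_top]
    | succ t ih =>
      rw [pow_succ] at hp
      refine Submodule.mul_induction_on hp (fun a ha b hb j => ?_) (fun a b ha hb j => ?_)
      · rw [coeff_mul]
        refine Ideal.sum_mem _ fun ⟨k, i⟩ hki => ?_
        replace hki : k + i = j := Finset.HasAntidiagonal.mem_antidiagonal.mp hki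
        have hb' := coeff_mem_of_mem_gradedIdeal h hb
        have ha' := ih ha k
        cases i with
        | zero =>
          have := Ideal.mul_mem_mul ha' hb'.1
          rw [mul_right_comm, ← pow_succ] at this
          exact pow_mul_pow_le h (by omega) (by omega) this
        | succ i =>
          have := Ideal.mul_mem_mul ha' (hb'.2 (i + 1))
          rw [mul_assoc, ← pow_succ] at this
          exact pow_mul_pow_le h (by omega) (by omega) this
      · rw [coeff_add]
        exact Ideal.add_mem _ (ha j) (hb j)
  · intro hp
    rw [p.as_sum_range_C_mul_X_pow]
    exact Ideal.sum_mem _ fun j _ => C_mul_X_pow_mem_gradedIdeal_pow (hp j)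

lemma C_mul_X_pow_mem_gradedIdeal_pow_iff {I J' : Ideal R} (h : I ≤ J') {t j : ℕ} {r : R} :
    C r * X ^ j ∈ gradedIdeal I J' ^ t ↔ r ∈ I ^ (t - j) * J' ^ min j t := by
  refine ⟨fun hr => ?_, C_mul_X_pow_mem_gradedIdeal_pow⟩
  simpa using (mem_gradedIdeal_pow_iff h).mp hr j

lemma xHomogeneous_gradedIdeal_pow {I J' : Ideal R} (h : I ≤ J') (t : ℕ) :
    XHomogeneous (gradedIdeal I J' ^ t) := fun _ hp j =>
  C_mul_X_pow_mem_gradedIdeal_pow ((mem_gradedIdeal_pow_iff h).mp hp j)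

lemma coeffIdeal_gradedIdeal_pow {I J' : Ideal R} (h : I ≤ J') (t j : ℕ) :
    coeffIdeal (gradedIdeal I J' ^ t) j = I ^ (t - j) * J' ^ min j t := by
  ext r
  rw [mem_coeffIdeal, C_mul_X_pow_mem_gradedIdeal_pow_iff h]

lemma coeffIdeal_gradedIdeal_pow_of_le {I J' : Ideal R} (h : I ≤ J') {t j : ℕ} (hj : t ≤ j) :
    coeffIdeal (gradedIdeal I J' ^ t) j = J' ^ t := by
  rw [coeffIdeal_gradedIdeal_pow h, Nat.sub_eq_zero_of_le hj, min_eq_right hj, pow_zero,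
    Ideal.one_eq_top, Ideal.top_mul]

lemma gradedIdeal_pow_sup_span_X_pow {I J' : Ideal R} (h : I ≤ J') {t k : ℕ} (hk : 1 ≤ k)
    (hkt : k ≤ t) :
    gradedIdeal I J' ^ t ⊔ Ideal.span {X ^ k} =
      I.map C ^ (t + 1 - k) * gradedIdeal I J' ^ (k - 1) ⊔ Ideal.span {X ^ k} := by
  refine le_antisymm (sup_le (fun p hp => ?_) le_sup_right) (sup_le_sup_right ?_ _)
  · rw [p.as_sum_range_C_mul_X_pow]
    refine Ideal.sum_mem _ fun j _ => ?_
    rcases lt_or_ge j k with hj | hj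
    · refine Ideal.mem_sup_left ?_
      have hc := (mem_gradedIdeal_pow_iff h).mp hp j
      -- For $j<k$ the component splits as $I^{t+1-k}$ times the degree $j$ component of the
      -- $(k-1)$-st power; degrees $j\ge k$ are absorbed by $X^k$.
      rw [show t - j = (t + 1 - k) + (k - 1 - j) by omega, pow_add, mul_assoc,
        show min j t = min j (k - 1) by omega] at hc
      rw [← Ideal.map_pow]
      refine Submodule.mul_induction_on hc (fun a ha b hb => ?_) (fun a b ha hb => ?_)
      · rw [C_mul, mul_assoc]
        exact Ideal.mul_mem_mul (Ideal.mem_map_of_mem C ha) (C_mul_X_pow_mem_gradedIdeal_pow hb)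
      · rw [C_add, add_mul]
        exact Ideal.add_mem _ ha hb
    · refine Ideal.mem_sup_right (Ideal.mem_span_singleton.mpr ?_)
      exact (pow_dvd_pow X hj).mul_left _
  · calc I.map C ^ (t + 1 - k) * gradedIdeal I J' ^ (k - 1)
        ≤ gradedIdeal I J' ^ (t + 1 - k) * gradedIdeal I J' ^ (k - 1) :=
          Ideal.mul_mono_left (Ideal.pow_right_mono le_sup_left _)
      _ = gradedIdeal I J' ^ t := by rw [← pow_add]; congr 1; omega

lemma mem_colon_X_pow_iff {I J' : Ideal R} (h : I ≤ J') {t k : ℕ} {p : R[X]} :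
    p ∈ (gradedIdeal I J' ^ t).colon {X ^ k} ↔
      ∀ j, p.coeff j ∈ I ^ (t - (j + k)) * J' ^ min (j + k) t := by
  rw [Submodule.mem_colon_singleton, smul_eq_mul, mem_gradedIdeal_pow_iff h]
  constructor
  · intro hp j
    simpa using hp (j + k)
  · intro hp j
    rw [coeff_mul_X_pow']
    split_ifs with hj
    · have := hp (j - k)
      rwa [Nat.sub_add_cancel hj] at this
    · exact Ideal.zero_mem _

/-- The colon by $X^{k-1}$ shifts degrees by $k-1$, and modulo $X$ only the new degree 0 component
remains. -/
lemma gradedIdeal_pow_colon_sup_span_X {I J' : Ideal R} (h : I ≤ J') {t k : ℕ} (hk : 1 ≤ k)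
    (hkt : k ≤ t) :
    (gradedIdeal I J' ^ t).colon {X ^ (k - 1)} ⊔ Ideal.span {X} =
      (I ^ (t + 1 - k) * J' ^ (k - 1)).map C ⊔ Ideal.span {X} := by
  refine le_antisymm (sup_le (fun p hp => ?_) le_sup_right) (sup_le_sup_right ?_ _)
  · have h0 := (mem_colon_X_pow_iff h).mp hp 0
    rw [zero_add, show t - (k - 1) = t + 1 - k by omega, show min (k - 1) t = k - 1 by omega] at h0
    rw [← p.divX_mul_X_add]
    exact Ideal.add_mem _ (Ideal.mem_sup_right (Ideal.mem_span_singleton'.mpr ⟨_, rfl⟩))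
      (Ideal.mem_sup_left (Ideal.mem_map_of_mem C h0))
  · intro p hp
    rw [Ideal.mem_map_C_iff] at hp
    exact (mem_colon_X_pow_iff h).mpr fun j => pow_mul_pow_le h (by omega) (by omega) (hp j)

lemma gradedIdeal_pow_colon_X_pow {I J' : Ideal R} (h : I ≤ J') (t : ℕ) :
    (gradedIdeal I J' ^ t).colon {X ^ t} = (J' ^ t).map C := by
  ext p
  rw [mem_colon_X_pow_iff h, Ideal.mem_map_C_iff]
  refine forall_congr' fun j => ?_
  rw [Nat.sub_eq_zero_of_le (Nat.le_add_left t j), min_eq_right (Nat.le_add_left t j), pow_zero,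
    Ideal.one_eq_top, Ideal.top_mul]

end Powers

/-! ### Transport of the identities along an isomorphism with $R[X]$. -/

section Transfer

open Polynomial

variable {R S : Type*} [CommRing R] [CommRing S]

lemma map_colon_singleton (e : S ≃+* R) (J : Ideal S) (y : S) :
    (J.colon {y}).map e = (J.map e).colon {e y} := by
  ext p
  obtain ⟨q, rfl⟩ := e.surjective p
  have hmem : ∀ (Q : Ideal S) (a : S), e a ∈ Q.map e ↔ a ∈ Q := fun Q a => by
    rw [Ideal.mem_map_of_equiv]
    exact ⟨fun ⟨b, hb, hba⟩ => e.injective hba ▸ hb, fun ha => ⟨a, ha, rfl⟩⟩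
  rw [hmem, Submodule.mem_colon_singleton, Submodule.mem_colon_singleton, smul_eq_mul, smul_eq_mul,
    ← map_mul, hmem]

/-- The identities between the powers of `J`, in a ring that is isomorphic to `R[X]`. -/
lemma power_identities (e : S ≃+* R[X]) (ι : R →+* S) (x : S) (hι : ∀ r, e (ι r) = C r)
    (hx : e x = X) {I J' : Ideal R} {J : Ideal S} (h : I ≤ J') (hJ : J.map e = gradedIdeal I J')
    (t : ℕ) :
    (∀ k : ℕ, 1 ≤ k → k ≤ t →
      J ^ t ⊔ Ideal.span {x ^ k} = I.map ι ^ (t + 1 - k) * J ^ (k - 1) ⊔ Ideal.span {x ^ k}) ∧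
    (∀ k : ℕ, 1 ≤ k → k ≤ t →
      (J ^ t).colon {x ^ (k - 1)} ⊔ Ideal.span {x} =
        (I ^ (t + 1 - k) * J' ^ (k - 1)).map ι ⊔ Ideal.span {x}) ∧
    (J ^ t).colon {x ^ t} = (J' ^ t).map ι := by
  have hinj : Function.Injective (Ideal.map e) := fun P Q hPQ => by
    rw [← Ideal.comap_map_of_bijective e e.bijective (I := P), hPQ,
      Ideal.comap_map_of_bijective e e.bijective]
  have hιe : ∀ Q : Ideal R, (Q.map ι).map e = Q.map C := fun Q => by
    rw [← Ideal.map_coe e, Ideal.map_map]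
    congr 1
    exact RingHom.ext hι
  refine ⟨fun k hk hkt => hinj ?_, fun k hk hkt => hinj ?_, hinj ?_⟩
  · simpa only [Ideal.map_sup, Ideal.map_mul, Ideal.map_pow, Ideal.map_span, Set.image_singleton,
      map_pow, hx, hJ, hιe] using gradedIdeal_pow_sup_span_X_pow h hk hkt
  · rw [Ideal.map_sup, Ideal.map_sup, hιe, map_colon_singleton, Ideal.map_pow, Ideal.map_span,
      Set.image_singleton, map_pow, hx, hJ]
    exact gradedIdeal_pow_colon_sup_span_X h hk hkt
  · rw [hιe, map_colon_singleton, Ideal.map_pow, map_pow, hx, hJ]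
    exact gradedIdeal_pow_colon_X_pow h t

end Transfer

/-! ### Stanley decompositions as partitions of monomials. -/

section Stanley

open MvPolynomial

variable {K : Type*} [Field K] {σ : Type*}

/-- `I` contains every monomial that occurs in one of its elements. -/
def MonomialClosed (I : Ideal (MvPolynomial σ K)) : Prop :=
  ∀ p ∈ I, ∀ u, coeff u p ≠ 0 → monomial u (1 : K) ∈ I

/-- `I` is generated by monomials. -/
def IsMonomialIdeal (I : Ideal (MvPolynomial σ K)) : Prop :=
  ∃ s : Set (σ →₀ ℕ), I = Ideal.span ((fun u => monomial u (1 : K)) '' s)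

lemma IsMonomialIdeal.monomialClosed {I : Ideal (MvPolynomial σ K)} (h : IsMonomialIdeal I) :
    MonomialClosed I := by
  obtain ⟨s, rfl⟩ := h
  intro p hp u hu
  obtain ⟨v, hv, hvu⟩ := mem_ideal_span_monomial_image.mp hp u (mem_support_iff.mpr hu)
  refine mem_ideal_span_monomial_image.mpr fun w hw => ?_
  rw [Finset.mem_singleton.mp (support_monomial_subset hw)]
  exact ⟨v, hv, hvu⟩

lemma IsMonomialIdeal.mul {I J : Ideal (MvPolynomial σ K)} (hI : IsMonomialIdeal I)
    (hJ : IsMonomialIdeal J) : IsMonomialIdeal (I * J) := by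
  obtain ⟨s, rfl⟩ := hI
  obtain ⟨t, rfl⟩ := hJ
  refine ⟨Set.image2 (· + ·) s t, ?_⟩
  rw [Ideal.span_mul_span', Set.image_image2]
  congr 1
  ext p
  simp [Set.mem_mul, Set.mem_image2, monomial_mul]

lemma IsMonomialIdeal.sup {I J : Ideal (MvPolynomial σ K)} (hI : IsMonomialIdeal I)
    (hJ : IsMonomialIdeal J) : IsMonomialIdeal (I ⊔ J) := by
  obtain ⟨s, rfl⟩ := hI
  obtain ⟨t, rfl⟩ := hJ
  exact ⟨s ∪ t, by rw [Set.image_union, Ideal.span_union]⟩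

lemma IsMonomialIdeal.pow {I : Ideal (MvPolynomial σ K)} (hI : IsMonomialIdeal I) (t : ℕ) :
    IsMonomialIdeal (I ^ t) := by
  induction t with
  | zero => exact ⟨{0}, by simp [Ideal.one_eq_top, ← C_apply]⟩
  | succ t ih => rw [pow_succ]; exact ih.mul hI

lemma isMonomialIdeal_span {G : Set (MvPolynomial σ K)}
    (h : ∀ g ∈ G, ∃ u, g = monomial u (1 : K)) : IsMonomialIdeal (Ideal.span G) := by
  refine ⟨{u | monomial u (1 : K) ∈ G}, congrArg _ (Set.ext fun g => ⟨fun hg => ?_, ?_⟩)⟩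
  · obtain ⟨u, rfl⟩ := h g hg
    exact ⟨u, hg, rfl⟩
  · rintro ⟨u, hu, rfl⟩
    exact hu

/-- The monomials outside `I` are partitioned by the sets of the monomials in `x^{a_i} K[Z_i]`. -/
structure IsMonomialPartition (I : Ideal (MvPolynomial σ K)) {ι : Type*} (a : ι → σ →₀ ℕ)
    (Z : ι → Finset σ) : Prop where
  notMem : ∀ i c, c.support ⊆ Z i → monomial (a i + c) (1 : K) ∉ I
  exists_eq : ∀ u, monomial u (1 : K) ∉ I → ∃ i c, c.support ⊆ Z i ∧ u = a i + c
  index_eq : ∀ i j c d, c.support ⊆ Z i → d.support ⊆ Z j → a i + c = a j + d → i = j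

lemma stanleyMap_apply (I : Ideal (MvPolynomial σ K)) (a : σ →₀ ℕ) (Z : Finset σ)
    (p : supported K (Z : Set σ)) :
    stanleyMap I a Z p = Ideal.Quotient.mk I (monomial a 1 * (p : MvPolynomial σ K)) := rfl

lemma monomial_mem_supported {Z : Finset σ} {c : σ →₀ ℕ} (h : c.support ⊆ Z) :
    monomial c (1 : K) ∈ supported K (Z : Set σ) := by
  rw [mem_supported, vars_monomial one_ne_zero]
  exact_mod_cast h

lemma support_subset_of_mem_supported {Z : Finset σ} {p : MvPolynomial σ K}
    (h : p ∈ supported K (Z : Set σ)) {c : σ →₀ ℕ} (hc : coeff c p ≠ 0) : c.support ⊆ Z := by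
  intro i hi
  exact mem_supported.mp h ((mem_vars_iff_mem_support i).mpr ⟨c, mem_support_iff.mpr hc, hi⟩)

lemma StanleyDecomposition.isMonomialPartition {I : Ideal (MvPolynomial σ K)}
    (hI : MonomialClosed I) (D : StanleyDecomposition I) : IsMonomialPartition I D.a D.Z := by
  classical
  have hmk : ∀ i c, c.support ⊆ D.Z i →
      Ideal.Quotient.mk I (monomial (D.a i + c) (1 : K)) ∈
        LinearMap.range (stanleyMap I (D.a i) (D.Z i)) := by
    intro i c hc
    refine ⟨⟨_, monomial_mem_supported hc⟩, ?_⟩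
    rw [stanleyMap_apply, monomial_mul, one_mul]
  have hnot : ∀ i c, c.support ⊆ D.Z i → monomial (D.a i + c) (1 : K) ∉ I := by
    intro i c hc hmem
    have h0 : stanleyMap I (D.a i) (D.Z i) ⟨_, monomial_mem_supported hc⟩ =
        stanleyMap I (D.a i) (D.Z i) 0 := by
      rw [stanleyMap_apply, monomial_mul, one_mul, map_zero]
      exact Ideal.Quotient.eq_zero_iff_mem.mpr hmem
    have := congrArg Subtype.val (D.free i h0)
    exact one_ne_zero (monomial_eq_zero.mp this)
  refine ⟨hnot, fun u hu => ?_, fun i j c d hc hd hcd => ?_⟩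
  · have htop : Ideal.Quotient.mk I (monomial u (1 : K)) ∈
        ⨆ i, LinearMap.range (stanleyMap I (D.a i) (D.Z i)) := by
      rw [D.isInternal.submodule_iSup_eq_top]
      trivial
    obtain ⟨f, hf, hsum⟩ := (Submodule.mem_iSup_iff_exists_finsupp _ _).mp htop
    choose p hp using hf
    rw [Finsupp.sum_fintype _ _ (fun _ => rfl)] at hsum
    simp only [← hp, stanleyMap_apply] at hsum
    rw [← map_sum, Ideal.Quotient.eq] at hsum
    -- The difference lies in `I`, which contains every monomial occurring in it, whereas $x^u\notin
    -- I$. So some summand has $x^u$ in its support.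
    have hz : coeff u (∑ i, monomial (D.a i) 1 * (p i : MvPolynomial σ K) - monomial u 1) = 0 := by
      by_contra hne
      exact hu (hI _ hsum u hne)
    rw [coeff_sub, coeff_monomial, if_pos rfl, sub_eq_zero, coeff_sum] at hz
    obtain ⟨i, -, hi⟩ := Finset.exists_ne_zero_of_sum_ne_zero (hz.trans_ne one_ne_zero)
    rw [coeff_monomial_mul', one_mul] at hi
    have hle : D.a i ≤ u := by
      by_contra hle
      exact hi (if_neg hle)
    rw [if_pos hle] at hi
    exact ⟨i, u - D.a i, support_subset_of_mem_supported (p i).2 hi,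
      (add_tsub_cancel_of_le hle).symm⟩
  · by_contra hij
    have hdis := D.isInternal.submodule_iSupIndep.pairwiseDisjoint hij
    have h0 := Submodule.disjoint_def.mp hdis _ (hmk i c hc) (hcd ▸ hmk j d hd)
    exact hnot i c hc (Ideal.Quotient.eq_zero_iff_mem.mp h0)

/-- The Stanley decomposition given by a partition of the monomials. -/
noncomputable def IsMonomialPartition.stanleyDecomposition {I : Ideal (MvPolynomial σ K)}
    (hI : MonomialClosed I) {r : ℕ} {a : Fin r → σ →₀ ℕ} {Z : Fin r → Finset σ}
    (h : IsMonomialPartition I a Z) : StanleyDecomposition I where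
  r := r
  a := a
  Z := Z
  free := by
    intro i
    rw [injective_iff_map_eq_zero]
    intro p hp
    rw [stanleyMap_apply, Ideal.Quotient.eq_zero_iff_mem] at hp
    by_contra hne
    obtain ⟨c, hc⟩ := ne_zero_iff.mp (fun h0 => hne (Subtype.ext h0) : (p : MvPolynomial σ K) ≠ 0)
    refine h.notMem i c (support_subset_of_mem_supported p.2 hc) (hI _ hp _ ?_)
    rwa [coeff_monomial_mul, one_mul]
  isInternal := by
    refine DirectSum.isInternal_submodule_of_iSupIndep_of_iSup_eq_top ?_ ?_
    · rw [iSupIndep_iff_finsetSum_eq_zero_imp_eq_zero]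
      intro s v hv hsum i hi
      have hv' : ∀ j, ∃ p : supported K (Z j : Set σ), j ∈ s → stanleyMap I (a j) (Z j) p = v j := by
        intro j
        by_cases hj : j ∈ s
        · obtain ⟨p, hp⟩ := hv j hj
          exact ⟨p, fun _ => hp⟩
        · exact ⟨0, fun hj' => absurd hj' hj⟩
      choose p hp using hv'
      rw [← Finset.sum_congr rfl hp] at hsum
      simp only [stanleyMap_apply] at hsum
      rw [← map_sum, Ideal.Quotient.eq_zero_iff_mem] at hsum
      suffices p i = 0 by rw [← hp i hi, this, map_zero]
      by_contra hne
      obtain ⟨c, hc⟩ := ne_zero_iff.mp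
        (fun h0 => hne (Subtype.ext h0) : (p i : MvPolynomial σ K) ≠ 0)
      have hcZ := support_subset_of_mem_supported (p i).2 hc
      refine h.notMem i c hcZ (hI _ hsum _ ?_)
      rw [coeff_sum, Finset.sum_eq_single_of_mem i hi, coeff_monomial_mul, one_mul]
      · exact hc
      · intro j _ hji
        rw [coeff_monomial_mul', one_mul]
        split_ifs with hle
        · by_contra hd
          exact hji (h.index_eq j i _ c (support_subset_of_mem_supported (p j).2 hd) hcZ
            (add_tsub_cancel_of_le hle))
        · rfl
    · rw [eq_top_iff]
      rintro x -
      obtain ⟨p, rfl⟩ := Ideal.Quotient.mk_surjective x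
      have hmon : ∀ u, ∀ k : K, Ideal.Quotient.mk I (monomial u k) ∈
          ⨆ i, LinearMap.range (stanleyMap I (a i) (Z i)) := by
        intro u k
        have hk : Ideal.Quotient.mk I (monomial u k) =
            k • Ideal.Quotient.mk I (monomial u (1 : K)) := by
          rw [← mul_one k, ← smul_eq_mul, ← smul_monomial]
          simp only [smul_eq_mul, mul_one]
          exact map_smul (Ideal.Quotient.mkₐ K I) k _
        rw [hk]
        refine Submodule.smul_mem _ _ ?_
        by_cases hu : monomial u (1 : K) ∈ I
        · rw [Ideal.Quotient.eq_zero_iff_mem.mpr hu]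
          exact Submodule.zero_mem _
        · obtain ⟨i, c, hc, rfl⟩ := h.exists_eq u hu
          refine Submodule.mem_iSup_of_mem i ⟨⟨_, monomial_mem_supported hc⟩, ?_⟩
          rw [stanleyMap_apply, monomial_mul, one_mul]
      rw [p.as_sum, map_sum]
      exact Submodule.sum_mem _ fun u _ => hmon u _

end Stanley

/-! ### Slicing a Stanley decomposition at a large exponent of the last variable. -/

section Slice

open MvPolynomial

variable {K : Type*} [Field K] {N : ℕ}

/-- The exponent vector `u` in the first `N` variables, extended by the exponent `T` in the last. -/
noncomputable def snocExp (u : Fin N →₀ ℕ) (T : ℕ) : Fin (N + 1) →₀ ℕ :=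
  u.mapDomain Fin.castSucc + Finsupp.single (Fin.last N) T

@[simp] lemma snocExp_castSucc (u : Fin N →₀ ℕ) (T : ℕ) (i : Fin N) :
    snocExp u T i.castSucc = u i := by
  rw [snocExp, Finsupp.add_apply, Finsupp.mapDomain_apply (Fin.castSucc_injective N),
    Finsupp.single_eq_of_ne (Fin.castSucc_lt_last i).ne, add_zero]

@[simp] lemma snocExp_last (u : Fin N →₀ ℕ) (T : ℕ) : snocExp u T (Fin.last N) = T := by
  rw [snocExp, Finsupp.add_apply, Finsupp.mapDomain_of_notMem_range _ _ (by
    rintro ⟨i, hi⟩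
    exact (Fin.castSucc_lt_last i).ne hi), Finsupp.single_eq_same, zero_add]

/-- The exponents of the first `N` variables. -/
noncomputable def initExp (u : Fin (N + 1) →₀ ℕ) : Fin N →₀ ℕ :=
  Finsupp.equivFunOnFinite.symm fun i => u i.castSucc

@[simp] lemma initExp_apply (u : Fin (N + 1) →₀ ℕ) (i : Fin N) : initExp u i = u i.castSucc := rfl

lemma sdepth_le_sdepth_add_one {J : Ideal (MvPolynomial (Fin (N + 1)) K)}
    {Q : Ideal (MvPolynomial (Fin N) K)} (hJ : MonomialClosed J) (hQ : MonomialClosed Q) {T₀ : ℕ}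
    (hJQ : ∀ u, ∀ T ≥ T₀, monomial (snocExp u T) (1 : K) ∈ J ↔ monomial u (1 : K) ∈ Q) :
    sdepth J ≤ sdepth Q + 1 := by
  refine iSup_le fun D => ?_
  have hD := D.isMonomialPartition hJ
  -- The bound must be strict: then a piece meets the slice at exponent `T` exactly when the last
  -- variable belongs to `Z i`.
  obtain ⟨T, hT₀, hT⟩ : ∃ T, T₀ ≤ T ∧ ∀ i, D.a i (Fin.last N) < T := by
    refine ⟨T₀ + ∑ i, D.a i (Fin.last N) + 1, by omega, fun i => ?_⟩
    have := Finset.single_le_sum (f := fun i => D.a i (Fin.last N)) (fun _ _ => Nat.zero_le _)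
      (Finset.mem_univ i)
    omega
  let A : Finset (Fin D.r) := {i | Fin.last N ∈ D.Z i}
  let g : Fin A.card → Fin D.r := A.orderEmbOfFin rfl
  have hg : ∀ k, Fin.last N ∈ D.Z (g k) := fun k => by
    exact (Finset.mem_filter.mp (A.orderEmbOfFin_mem rfl k)).2
  let Z' : Fin D.r → Finset (Fin N) := fun i => Finset.univ.filter fun l => l.castSucc ∈ D.Z i
  have hsupp : ∀ i (c : Fin N →₀ ℕ) s, Fin.last N ∈ D.Z i → c.support ⊆ Z' i →
      (snocExp c s).support ⊆ D.Z i := by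
    intro i c s hi hc l hl
    induction l using Fin.lastCases with
    | last => exact hi
    | cast l =>
      have : l ∈ Z' i := hc (by simpa using hl)
      simpa [Z'] using this
  have hadd : ∀ i (c : Fin N →₀ ℕ),
      snocExp (initExp (D.a i) + c) T = D.a i + snocExp c (T - D.a i (Fin.last N)) := by
    intro i c
    ext l
    induction l using Fin.lastCases with
    | last => simpa using (Nat.add_sub_cancel' (hT i).le).symm
    | cast l => simp
  have hpart : IsMonomialPartition Q (fun k => initExp (D.a (g k))) (fun k => Z' (g k)) := by
    refine ⟨fun k c hc hmem => ?_, fun u hu => ?_, fun k l c d hc hd hcd => ?_⟩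
    · rw [← hJQ _ T hT₀, hadd] at hmem
      exact hD.notMem _ _ (hsupp _ _ _ (hg k) hc) hmem
    · rw [← hJQ _ T hT₀] at hu
      obtain ⟨i, c, hc, huc⟩ := hD.exists_eq _ hu
      have hlast : Fin.last N ∈ D.Z i := by
        have := DFunLike.congr_fun huc (Fin.last N)
        rw [snocExp_last, Finsupp.add_apply] at this
        refine hc (Finsupp.mem_support_iff.mpr ?_)
        have := hT i
        omega
      obtain ⟨k, rfl⟩ : i ∈ Set.range g := by
        rw [Finset.range_orderEmbOfFin]
        simpa [A] using hlast
      refine ⟨k, initExp c, fun l hl => ?_, ?_⟩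
      · have : l.castSucc ∈ D.Z (g k) := hc (by simpa using hl)
        simpa [Z'] using this
      · ext l
        simpa using DFunLike.congr_fun huc l.castSucc
    · refine (A.orderEmbOfFin rfl).injective (hD.index_eq _ _
        (snocExp c (T - D.a (g k) (Fin.last N))) (snocExp d (T - D.a (g l) (Fin.last N)))
        (hsupp _ c _ (hg k) hc) (hsupp _ d _ (hg l) hd) ?_)
      rw [← hadd, ← hadd]
      exact congrArg (snocExp · T) hcd
  refine le_trans ?_ (add_le_add_left
    (le_iSup StanleyDecomposition.sdepth (hpart.stanleyDecomposition hQ)) 1)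
  rw [StanleyDecomposition.sdepth, StanleyDecomposition.sdepth, ENat.iInf_add]
  refine le_iInf fun k => (iInf_le _ (g k)).trans ?_
  have hcard : (D.Z (g k)).card ≤ (Z' (g k)).card + 1 := by
    have hsub : D.Z (g k) ⊆ insert (Fin.last N) ((Z' (g k)).image Fin.castSucc) := by
      intro l hl
      induction l using Fin.lastCases with
      | last => simp
      | cast l => simpa [Z'] using hl
    exact (Finset.card_le_card hsub).trans
      ((Finset.card_insert_le _ _).trans (Nat.add_le_add_right Finset.card_image_le 1))
  exact_mod_cast hcard

end Slice

/-! ### The last variable as a polynomial variable, and the depth bound. -/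

section LastVariable

open MvPolynomial

variable (K : Type*) [Field K] (N : ℕ)

/-- `K[x_1, …, x_{N+1}]` as the polynomial ring in the last variable over `K[x_1, …, x_N]`. -/
noncomputable def lastVarEquiv :
    MvPolynomial (Fin (N + 1)) K ≃+* Polynomial (MvPolynomial (Fin N) K) :=
  ((renameEquiv K finSuccEquivLast).trans (optionEquivLeft K (Fin N))).toRingEquiv

variable {K N}

lemma lastVarEquiv_X_last : lastVarEquiv K N (X (Fin.last N)) = Polynomial.X := by
  change optionEquivLeft K (Fin N) (rename finSuccEquivLast (X (Fin.last N))) = _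
  rw [rename_X, finSuccEquivLast_last, optionEquivLeft_X_none]

lemma lastVarEquiv_rename (p : MvPolynomial (Fin N) K) :
    lastVarEquiv K N (rename Fin.castSucc p) = Polynomial.C p := by
  change optionEquivLeft K (Fin N) (rename finSuccEquivLast (rename Fin.castSucc p)) = _
  rw [rename_rename]
  induction p using MvPolynomial.induction_on with
  | C a => rw [rename_C, optionEquivLeft_C]
  | add p q hp hq => rw [map_add, map_add, map_add, hp, hq]
  | mul_X p i hp =>
    rw [map_mul, map_mul, hp, rename_X, Function.comp_apply, finSuccEquivLast_castSucc,
      optionEquivLeft_X_some, map_mul]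

lemma map_lastVarEquiv_span_range_X :
    (Ideal.span (Set.range (X : Fin (N + 1) → MvPolynomial (Fin (N + 1)) K))).map
        (lastVarEquiv K N) =
      (Ideal.span (Set.range (X : Fin N → MvPolynomial (Fin N) K))).map Polynomial.C ⊔
        Ideal.span {Polynomial.X} := by
  rw [Ideal.map_span, Ideal.map_span, ← Ideal.span_union, ← Set.range_comp, ← Set.range_comp]
  congr 1
  ext f
  simp only [Set.mem_range, Set.mem_union, Set.mem_singleton_iff, Function.comp_apply]
  rw [Fin.exists_fin_succ', lastVarEquiv_X_last, eq_comm (a := Polynomial.X)]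
  simp only [← rename_X, lastVarEquiv_rename]

lemma mem_map_lastVarEquiv {J : Ideal (MvPolynomial (Fin (N + 1)) K)}
    {p : MvPolynomial (Fin (N + 1)) K} :
    lastVarEquiv K N p ∈ J.map (lastVarEquiv K N) ↔ p ∈ J := by
  rw [Ideal.mem_map_of_equiv]
  exact ⟨fun ⟨q, hq, h⟩ => (lastVarEquiv K N).injective h ▸ hq, fun h => ⟨p, h, rfl⟩⟩

lemma monomial_snocExp (u : Fin N →₀ ℕ) (T : ℕ) :
    monomial (snocExp u T) (1 : K) = rename Fin.castSucc (monomial u 1) * X (Fin.last N) ^ T := by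
  rw [rename_monomial, X_pow_eq_monomial, monomial_mul, one_mul, snocExp]

lemma monomial_snocExp_mem_iff {J : Ideal (MvPolynomial (Fin (N + 1)) K)} {u : Fin N →₀ ℕ}
    {T : ℕ} : monomial (snocExp u T) (1 : K) ∈ J ↔
      monomial u 1 ∈ coeffIdeal (J.map (lastVarEquiv K N)) T := by
  rw [mem_coeffIdeal, ← mem_map_lastVarEquiv, monomial_snocExp, map_mul, map_pow,
    lastVarEquiv_rename, lastVarEquiv_X_last]

lemma span_range_X_ne_top {σ : Type*} :
    Ideal.span (Set.range (X : σ → MvPolynomial σ K)) ≠ ⊤ := by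
  intro h
  have hle : Ideal.span (Set.range (X : σ → MvPolynomial σ K)) ≤
      RingHom.ker (constantCoeff : MvPolynomial σ K →+* K) := by
    rw [Ideal.span_le]
    rintro _ ⟨i, rfl⟩
    exact constantCoeff_X K i
  rw [h] at hle
  have : (1 : MvPolynomial σ K) ∈ RingHom.ker (constantCoeff : MvPolynomial σ K →+* K) := hle trivial
  rw [RingHom.mem_ker, map_one] at this
  exact one_ne_zero this

/-- The sequence multiplies $A/Q$ into the proper submodule $\mathfrak m/Q$. -/
lemma isRegular_of_isWeaklyRegular {A : Type*} [CommRing A] {m Q : Ideal A} (hm : m ≠ ⊤)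
    (hQ : Q ≤ m) {rs : List A} (hrs : ∀ r ∈ rs, r ∈ m)
    (h : RingTheory.Sequence.IsWeaklyRegular (A ⧸ Q) rs) :
    RingTheory.Sequence.IsRegular (A ⧸ Q) rs := by
  refine ⟨h, fun htop => hm ?_⟩
  have hle : (Ideal.ofList rs • ⊤ : Submodule A (A ⧸ Q)) ≤ Submodule.map (Submodule.mkQ Q) m := by
    refine Submodule.smul_le.mpr fun r hr x _ => ?_
    obtain ⟨a, rfl⟩ := Submodule.mkQ_surjective Q x
    rw [← map_smul]
    have hrm : r ∈ m := (Ideal.span_le.mpr hrs : Ideal.ofList rs ≤ m) hr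
    exact Submodule.mem_map_of_mem (m.mul_mem_right a hrm)
  rw [← htop] at hle
  obtain ⟨y, hy, hy1⟩ := hle (Submodule.mem_top : Submodule.mkQ Q 1 ∈ ⊤)
  rw [Ideal.eq_top_iff_one]
  have h1 : y - 1 ∈ Q := (Submodule.Quotient.eq Q).mp hy1
  convert m.sub_mem hy (hQ h1) using 1
  ring

lemma depth_quotient_le_add_one {J : Ideal (MvPolynomial (Fin (N + 1)) K)}
    {Q : Ideal (MvPolynomial (Fin N) K)} (hJ : XHomogeneous (J.map (lastVarEquiv K N))) {T : ℕ}
    (hT : ∀ j ≥ T, coeffIdeal (J.map (lastVarEquiv K N)) j = Q)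
    (hQ : Q ≤ Ideal.span (Set.range X)) :
    depth K (Fin (N + 1)) (MvPolynomial (Fin (N + 1)) K ⧸ J) ≤
      depth K (Fin N) (MvPolynomial (Fin N) K ⧸ Q) + 1 := by
  refine iSup₂_le fun rs hrs => ?_
  rcases hl : rs.length with _ | d
  · exact zero_le
  have hd := (depthGE_iff_exists_isWeaklyRegular (m := Ideal.span (Set.range X)) (d + 1) _
    (Submodule.mkQ J) (Submodule.mkQ_surjective J)).mpr ⟨rs, hl, hrs.1, hrs.2.toIsWeaklyRegular⟩
  rw [Submodule.ker_mkQ] at hd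
  have hd' := hd.map (lastVarEquiv K N)
  rw [map_lastVarEquiv_span_range_X] at hd'
  have hdQ := hJ.depthGE_coeffIdeal (T := T) (fun j hj => (hT j hj).trans (hT T le_rfl).symm) hd'
  rw [hT T le_rfl, ← Submodule.ker_mkQ Q,
    depthGE_iff_exists_isWeaklyRegular _ _ _ (Submodule.mkQ_surjective Q)] at hdQ
  obtain ⟨rs', hl', hm', hrs'⟩ := hdQ
  rw [Nat.cast_add, Nat.cast_one]
  refine add_le_add_left ?_ 1
  rw [← hl']
  exact le_iSup₂_of_le rs' ⟨hm', isRegular_of_isWeaklyRegular span_range_X_ne_top hQ hm' hrs'⟩ le_rfl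

end LastVariable

/-! ### The cycle ideal as $I+XJ'$. -/

section Cycle

open MvPolynomial

variable (K : Type*) [Field K] (N m : ℕ)

/-- The ideal generated by the products of the variables other than `x_{N+1}` in the cyclic windows
of length `m` in `{1, …, N + 1}` that contain `N + 1`. -/
noncomputable def linkIdeal : Ideal (MvPolynomial (Fin N) K) :=
  Ideal.span {g | ∃ i : ℕ, i < N + 1 ∧ N + 1 ≤ i + m ∧
    g = ∏ l : Fin N with i ≤ l.val ∨ l.val + (N + 1) < i + m, X l}

variable {K N m}

lemma prod_filter_X (P : ℕ → Prop) [DecidablePred P] :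
    ∏ l : Fin (N + 1) with P l.val, (X l : MvPolynomial (Fin (N + 1)) K) =
      (if P N then X (Fin.last N) else 1) *
        rename Fin.castSucc (∏ l : Fin N with P l.val, X l) := by
  rw [Finset.prod_filter, Fin.prod_univ_castSucc, Finset.prod_filter, map_prod, mul_comm]
  congr 1
  refine Finset.prod_congr rfl fun l _ => ?_
  rw [apply_ite (rename Fin.castSucc), rename_X, map_one]
  rfl

lemma cycleIdeal_succ_eq (hm : 1 ≤ m) :
    cycleIdeal K (N + 1) m = (pathIdeal K N m).map (rename Fin.castSucc : _ →ₐ[K] _).toRingHom ⊔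
      Ideal.span {X (Fin.last N)} *
        (linkIdeal K N m).map (rename Fin.castSucc : _ →ₐ[K] _).toRingHom := by
  have hx : ∀ {g}, g ∈ linkIdeal K N m → X (Fin.last N) * rename Fin.castSucc g ∈
      Ideal.span {X (Fin.last N)} *
        (linkIdeal K N m).map (rename Fin.castSucc : _ →ₐ[K] _).toRingHom := fun hg =>
    Ideal.mul_mem_mul (Ideal.mem_span_singleton_self _) (Ideal.mem_map_of_mem _ hg)
  refine le_antisymm (sup_le ?_ ?_) (sup_le ?_ ?_)
  · refine Ideal.span_le.mpr ?_
    rintro _ ⟨i, hi, rfl⟩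
    rw [SetLike.mem_coe, prod_filter_X fun l => i ≤ l ∧ l < i + m]
    split_ifs with h
    · refine Ideal.mem_sup_right (hx (Ideal.subset_span ⟨i, by omega, by omega, ?_⟩))
      refine Finset.prod_congr (Finset.filter_congr fun l _ => ?_) fun _ _ => rfl
      have := l.isLt
      omega
    · rw [one_mul]
      exact Ideal.mem_sup_left (Ideal.mem_map_of_mem _ (Ideal.subset_span ⟨i, by omega, rfl⟩))
  · refine Ideal.span_le.mpr ?_
    rintro _ ⟨i, hi, him, rfl⟩
    rw [SetLike.mem_coe, prod_filter_X fun l => i ≤ l ∨ l + (N + 1) < i + m, if_pos (by omega)]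
    exact Ideal.mem_sup_right (hx (Ideal.subset_span ⟨i, hi, him.le, rfl⟩))
  · rw [pathIdeal, Ideal.map_span, Ideal.span_le]
    rintro _ ⟨_, ⟨i, hi, rfl⟩, rfl⟩
    refine Ideal.mem_sup_left (Ideal.subset_span ⟨i, by omega, ?_⟩)
    rw [prod_filter_X fun l => i ≤ l ∧ l < i + m, if_neg (by omega), one_mul]
    rfl
  · rw [linkIdeal, Ideal.map_span, Ideal.span_mul_span', Set.singleton_mul, Ideal.span_le]
    rintro _ ⟨_, ⟨_, ⟨i, hi, him, rfl⟩, rfl⟩, rfl⟩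
    -- With equality the window ends at the last variable and is a path generator; otherwise it
    -- wraps around.
    rcases him.eq_or_lt with him | him
    · refine Ideal.mem_sup_left (Ideal.subset_span ⟨i, him.ge, ?_⟩)
      rw [prod_filter_X fun l => i ≤ l ∧ l < i + m, if_pos (by omega)]
      refine congrArg (fun g => _ * rename Fin.castSucc g)
        (Finset.prod_congr (Finset.filter_congr fun l _ => ?_) fun _ _ => rfl)
      have := l.isLt
      omega
    · refine Ideal.mem_sup_right (Ideal.subset_span ⟨i, hi, him, ?_⟩)
      rw [prod_filter_X fun l => i ≤ l ∨ l + (N + 1) < i + m, if_pos (by omega)]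
      rfl

/-- Adding the path ideal to the link changes nothing, since $XI\subseteq I$; it secures the
inclusion $I\subseteq J'$ on which the computation of powers rests. -/
lemma map_cycleIdeal_succ (hm : 1 ≤ m) :
    (cycleIdeal K (N + 1) m).map (lastVarEquiv K N) =
      gradedIdeal (pathIdeal K N m) (pathIdeal K N m ⊔ linkIdeal K N m) := by
  have hC : ∀ Q : Ideal (MvPolynomial (Fin N) K),
      (Q.map (rename Fin.castSucc : _ →ₐ[K] MvPolynomial (Fin (N + 1)) K).toRingHom).map
        (lastVarEquiv K N) = Q.map Polynomial.C := fun Q => by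
    rw [← Ideal.map_coe (lastVarEquiv K N), Ideal.map_map]
    congr 1
    exact RingHom.ext lastVarEquiv_rename
  rw [cycleIdeal_succ_eq hm, Ideal.map_sup, Ideal.map_mul, Ideal.map_span,
    Set.image_singleton, lastVarEquiv_X_last, hC, hC, gradedIdeal, Ideal.map_sup, Ideal.mul_sup,
    ← sup_assoc, sup_eq_left.mpr (Ideal.mul_le_right : Ideal.span {Polynomial.X} *
      (pathIdeal K N m).map Polynomial.C ≤ _)]

lemma prod_X_eq_monomial {σ : Type*} (s : Finset σ) :
    ∃ u, ∏ l ∈ s, (X l : MvPolynomial σ K) = monomial u 1 :=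
  ⟨∑ l ∈ s, Finsupp.single l 1, (monomial_sum_one s _).symm⟩

lemma isMonomialIdeal_pathIdeal : IsMonomialIdeal (pathIdeal K N m) :=
  isMonomialIdeal_span (by
    rintro _ ⟨i, _, rfl⟩
    exact prod_X_eq_monomial _)

lemma isMonomialIdeal_linkIdeal : IsMonomialIdeal (linkIdeal K N m) :=
  isMonomialIdeal_span (by
    rintro _ ⟨i, _, _, rfl⟩
    exact prod_X_eq_monomial _)

lemma isMonomialIdeal_cycleIdeal : IsMonomialIdeal (cycleIdeal K N m) :=
  isMonomialIdeal_pathIdeal.sup (isMonomialIdeal_span (by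
    rintro _ ⟨i, _, _, rfl⟩
    exact prod_X_eq_monomial _))

lemma prod_X_mem_span_range_X {σ : Type*} {s : Finset σ} {l : σ} (hl : l ∈ s) :
    ∏ l ∈ s, (X l : MvPolynomial σ K) ∈ Ideal.span (Set.range (X : σ → MvPolynomial σ K)) :=
  Ideal.mem_of_dvd _ (Finset.dvd_prod_of_mem _ hl) (Ideal.subset_span ⟨l, rfl⟩)

lemma pathIdeal_sup_linkIdeal_le (hmN : m ≤ N) (hm : 2 ≤ m) :
    pathIdeal K N m ⊔ linkIdeal K N m ≤ Ideal.span (Set.range X) := by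
  refine sup_le (Ideal.span_le.mpr ?_) (Ideal.span_le.mpr ?_)
  · rintro _ ⟨i, hi, rfl⟩
    exact prod_X_mem_span_range_X (l := ⟨i, by omega⟩)
      (Finset.mem_filter.mpr ⟨Finset.mem_univ _, le_rfl, by simp only; omega⟩)
  · rintro _ ⟨i, hi, him, rfl⟩
    rcases (Nat.lt_succ_iff.mp hi).eq_or_lt with rfl | hi'
    -- The window starting at the removed variable still contains the first one, because $m\ge2$.
    · exact prod_X_mem_span_range_X (l := ⟨0, by omega⟩)
        (Finset.mem_filter.mpr ⟨Finset.mem_univ _, Or.inr (by simp only; omega)⟩)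
    · exact prod_X_mem_span_range_X (l := ⟨i, hi'⟩)
        (Finset.mem_filter.mpr ⟨Finset.mem_univ _, Or.inl le_rfl⟩)

/-- Membership of $r$ in the left side means $rX\in J$, so this is the degree 1 component of $J$. -/
lemma comap_cycleIdeal_colon (hm : 1 ≤ m) :
    ((cycleIdeal K (N + 1) m).colon {X (Fin.last N)}).comap
        (rename Fin.castSucc : _ →ₐ[K] _).toRingHom =
      pathIdeal K N m ⊔ linkIdeal K N m := by
  have h := coeffIdeal_gradedIdeal_pow_of_le
    (le_sup_left : pathIdeal K N m ≤ pathIdeal K N m ⊔ linkIdeal K N m) (le_refl 1)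
  rw [pow_one, pow_one, ← map_cycleIdeal_succ hm] at h
  rw [← h]
  ext r
  rw [mem_coeffIdeal, Ideal.mem_comap, Submodule.mem_colon_singleton, smul_eq_mul, pow_one,
    ← lastVarEquiv_rename, ← lastVarEquiv_X_last, ← map_mul, mem_map_lastVarEquiv]
  rfl

end Cycle

end CyclePath

open CyclePath in
theorem lemma3p1 (K : Type*) [Field K] (n m t : ℕ) (hm : 2 ≤ m) (hmn : m < n) (ht : 1 ≤ t) :
    let x : MvPolynomial (Fin n) K := MvPolynomial.X ⟨n - 1, by omega⟩
    let J : Ideal (MvPolynomial (Fin n) K) := cycleIdeal K n m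
    let J' : Ideal (MvPolynomial (Fin (n - 1)) K) := (J.colon {x}).comap (incl K n)
    let I : Ideal (MvPolynomial (Fin (n - 1)) K) := pathIdeal K (n - 1) m
    (∀ k : ℕ, 1 ≤ k → k ≤ t →
      J ^ t ⊔ Ideal.span {x ^ k} =
        I.map (incl K n) ^ (t + 1 - k) * J ^ (k - 1) ⊔ Ideal.span {x ^ k}) ∧
    (∀ k : ℕ, 1 ≤ k → k ≤ t →
      (J ^ t).colon {x ^ (k - 1)} ⊔ Ideal.span {x} =
        (I ^ (t + 1 - k) * J' ^ (k - 1)).map (incl K n) ⊔ Ideal.span {x}) ∧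
    (J ^ t ⊔ Ideal.span {x} = (I ^ t).map (incl K n) ⊔ Ideal.span {x} ∧
      (J ^ t).colon {x ^ t} = (J' ^ t).map (incl K n)) ∧
    (depth K (Fin n) (MvPolynomial (Fin n) K ⧸ J ^ t) ≤
        depth K (Fin (n - 1)) (MvPolynomial (Fin (n - 1)) K ⧸ J' ^ t) + 1 ∧
      sdepth (J ^ t) ≤ sdepth (J' ^ t) + 1) := by
  obtain ⟨N, rfl⟩ : ∃ N, n = N + 1 := ⟨n - 1, by omega⟩
  intro x J J' I
  have hmN : m ≤ N := by omega
  have hJ' : J' = pathIdeal K N m ⊔ linkIdeal K N m := comap_cycleIdeal_colon (by omega)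
  have hle : I ≤ J' := hJ' ▸ le_sup_left
  have hJ : J.map (lastVarEquiv K N) = gradedIdeal I J' := by
    rw [hJ']
    exact map_cycleIdeal_succ (by omega)
  have hJt : (J ^ t).map (lastVarEquiv K N) = gradedIdeal I J' ^ t := by rw [Ideal.map_pow, hJ]
  obtain ⟨h1, h2, h3⟩ := power_identities (lastVarEquiv K N) (incl K (N + 1)) x
    lastVarEquiv_rename lastVarEquiv_X_last hle hJ t
  have hcoeff : ∀ j ≥ t, coeffIdeal ((J ^ t).map (lastVarEquiv K N)) j = J' ^ t := fun j hj => by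
    rw [hJt]
    exact coeffIdeal_gradedIdeal_pow_of_le hle hj
  have hJm : IsMonomialIdeal J' :=
    hJ' ▸ isMonomialIdeal_pathIdeal.sup isMonomialIdeal_linkIdeal
  refine ⟨h1, h2, ⟨?_, h3⟩, ?_, ?_⟩
  -- This is the case $k=1$ of the first identity, where $J^{k-1}$ is the unit ideal.
  · simpa [Ideal.map_pow] using h1 1 le_rfl ht
  · refine depth_quotient_le_add_one (hJt ▸ xHomogeneous_gradedIdeal_pow hle t) hcoeff ?_
    exact (Ideal.pow_le_self (by omega)).trans (hJ' ▸ pathIdeal_sup_linkIdeal_le hmN hm)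
  · refine sdepth_le_sdepth_add_one (T₀ := t) (isMonomialIdeal_cycleIdeal.pow t).monomialClosed
      (hJm.pow t).monomialClosed fun u T hT => ?_
    rw [monomial_snocExp_mem_iff, hcoeff T hT]
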